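/- For nonzero integers $m,n$ let $BS(m,n)=\langle a,b\mid b^{-1}a^m b=a^n\rangle$ be the Baumslag–Solitar group. Let $V$ be Thompson's group $V$, i.e. the group of all bijections $f$ of the Cantor set $\{0,1\}^{\omega}$ for which there are two finite complete (that is, inclusion-maximal) antichains $D,R\subset\{0,1\}^*$ for the prefix order and a bijection $\sigma:D\to R$ with $f(dw)=\sigma(d)w$ for all $d\in D$ and $w\in\{0,1\}^{\omega}$. **Theorem.** Let $m,n$ be nonzero integers. 1. If $|m|\neq|n|$, then $BS(m,n)$ does not embed in $V$, i.e. there is no injective group homomorphism $BS(m,n)\to V$. 2. If $|m|=|n|$, then there is an injective group homomorphism $BS(m,n)\to V$. 3. More precisely, if $n=em$ with $e\in\{1,-1\}$, there are injective group homomorphisms $$BS(m,n)\to\big(\mathbb Z*(\mathbb Z/m\mathbb Z)\big)\times BS(1,e),\qquad \mathbb Z*(\mathbb Z/m\mathbb Z)\to V,\qquad BS(1,e)\to V,\qquad V\times V\to V,$$ so that $BS(m,n)$ embeds in $V$ through $\big(\mathbb Z*(\mathbb Z/m\mathbb Z)\big)\times BS(1,e)\le V\times V\le V$. -/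

import Mathlib

/-- The relator `(b⁻¹ * a ^ m * b) * (a ^ n)⁻¹` in the free group on `a = of 0` and `b = of 1`. -/
def bsRelator (m n : ℤ) : FreeGroup (Fin 2) :=
  ((FreeGroup.of 1)⁻¹ * FreeGroup.of 0 ^ m * FreeGroup.of 1) * (FreeGroup.of 0 ^ n)⁻¹

/-- The Baumslag-Solitar group `BS(m, n) = ⟨a, b ∣ b⁻¹ * a ^ m * b = a ^ n⟩`. -/
abbrev BaumslagSolitar (m n : ℤ) : Type :=
  PresentedGroup ({bsRelator m n} : Set (FreeGroup (Fin 2)))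

/-- A finite complete antichain of finite binary words: a finite set of words that is an antichain
for the prefix order and is maximal among all such antichains with respect to inclusion. -/
def IsCompleteAntichain (D : Finset (List Bool)) : Prop :=
  IsMaxAntichain (fun u v : List Bool => u <+: v) (D : Set (List Bool))

/-- `f` is a prefix code map of the Cantor set of infinite binary words: there are finite complete
antichains `D`, `R` of finite words and a bijection `σ : D ≃ R` such that `f` replaces the prefix
`d` by `σ d`, for every `d ∈ D`. -/
def IsPrefixCodeMap (f : Equiv.Perm (Stream' Bool)) : Prop :=
  ∃ (D R : Finset (List Bool)) (σ : D ≃ R), IsCompleteAntichain D ∧ IsCompleteAntichain R ∧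
    ∀ (d : D) (w : Stream' Bool), f (d.1 ++ₛ w) = (σ d).1 ++ₛ w

theorem IsCompleteAntichain.exists_comparable {D : Finset (List Bool)}
    (hD : IsCompleteAntichain D) (u : List Bool) : ∃ d ∈ D, d <+: u ∨ u <+: d := by
  by_contra! h
  have h1 : IsAntichain (fun u v : List Bool => u <+: v) (insert u (D : Set (List Bool))) :=
    hD.1.insert (fun d hd _ hdu => (h d hd).1 hdu) (fun d hd _ hud => (h d hd).2 hud)
  have h2 := hD.2 h1 (Set.subset_insert _ _)
  have h3 : u ∈ D := by
    have : u ∈ (D : Set (List Bool)) := by rw [h2]; exact Set.mem_insert _ _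
    exact this
  exact (h u h3).1 (List.prefix_refl u)

theorem stream_append_inj {u v : List Bool} {x y : Stream' Bool} (hl : u.length = v.length)
    (h : u ++ₛ x = v ++ₛ y) : u = v := by
  induction u generalizing v with
  | nil => cases v with
    | nil => rfl
    | cons b v => simp at hl
  | cons a u ih => cases v with
    | nil => simp at hl
    | cons b v =>
      rw [Stream'.cons_append_stream, Stream'.cons_append_stream] at h
      have h1 := congrArg Stream'.head h
      have h2 := congrArg Stream'.tail h
      simp only [Stream'.head_cons, Stream'.tail_cons] at h1 h2
      rw [h1, ih (by simpa using hl) h2]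

/-- A permutation is a prefix code map iff it replaces prefixes on all words of some fixed length. -/
theorem isPrefixCodeMap_iff (f : Equiv.Perm (Stream' Bool)) :
    IsPrefixCodeMap f ↔ ∃ N : ℕ, ∀ u : List Bool, u.length = N →
      ∃ v : List Bool, ∀ w : Stream' Bool, f (u ++ₛ w) = v ++ₛ w := by
  constructor
  · rintro ⟨D, R, σ, hD, -, hf⟩
    refine ⟨D.sup List.length, fun u hu => ?_⟩
    obtain ⟨d, hd, h⟩ := hD.exists_comparable u
    have hle : d.length ≤ u.length := hu ▸ Finset.le_sup (f := List.length) hd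
    have hpre : d <+: u := by
      rcases h with h | h
      · exact h
      · rw [h.eq_of_length_le hle]
    obtain ⟨s, rfl⟩ := hpre
    refine ⟨(σ ⟨d, hd⟩).1 ++ s, fun w => ?_⟩
    rw [Stream'.append_append_stream, Stream'.append_append_stream]
    exact hf ⟨d, hd⟩ _
  · rintro ⟨N, h⟩
    choose! v hv using h
    have key : ∀ u u' s, u.length = N → u'.length = N → v u ++ s = v u' → u = u' := by
      intro u u' s hu hu' e
      have h1 := hv u hu (s ++ₛ Stream'.const true)
      rw [← Stream'.append_append_stream (v u), e, ← hv u' hu'] at h1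
      exact stream_append_inj (hu.trans hu'.symm) (f.injective h1)
    have hfin : {u : List Bool | u.length = N}.Finite := List.finite_length_eq Bool N
    have hinj : ∀ u ∈ hfin.toFinset, ∀ u' ∈ hfin.toFinset, v u = v u' → u = u' := by
      intro u hu u' hu' e
      simp only [Set.Finite.mem_toFinset, Set.mem_ofPred_eq] at hu hu'
      exact key u u' [] hu hu' (by simpa using e)
    have hmax : ∀ E : Finset (List Bool),
        IsAntichain (fun u v : List Bool => u <+: v) (E : Set (List Bool)) →
        (∀ y : Stream' Bool, ∃ d ∈ E, ∃ w, y = d ++ₛ w) → IsCompleteAntichain E := by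
      intro E hE hc
      refine ⟨hE, fun t ht hEt => hEt.antisymm fun u hu => ?_⟩
      obtain ⟨d, hd, w, e⟩ := hc (u ++ₛ Stream'.const true)
      have hcomp : u <+: d ∨ d <+: u := by
        rcases le_total u.length d.length with hl | hl
        · left
          have e2 : d = d.take u.length ++ d.drop u.length := (List.take_append_drop _ _).symm
          rw [e2, Stream'.append_append_stream] at e
          rw [stream_append_inj (by simp [hl]) e]
          exact List.take_prefix _ _
        · right
          have e2 : u = u.take d.length ++ u.drop d.length := (List.take_append_drop _ _).symm
          rw [e2, Stream'.append_append_stream] at e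
          rw [← stream_append_inj (by simp [hl]) e]
          exact List.take_prefix _ _
      by_contra hne
      have hdu : d ≠ u := fun h' => hne (h' ▸ hd)
      rcases hcomp with h1 | h1
      · exact ht hu (hEt hd) hdu.symm h1
      · exact ht (hEt hd) hu hdu h1
    have hsplit : ∀ x : Stream' Bool, ∃ u w, u.length = N ∧ x = u ++ₛ w := fun x =>
      ⟨x.take N, x.drop N, Stream'.length_take _ _, (Stream'.append_take_drop N x).symm⟩
    refine ⟨hfin.toFinset, hfin.toFinset.image v,
      Equiv.ofBijective (fun d => ⟨v d.1, Finset.mem_image_of_mem v d.2⟩) ⟨?_, ?_⟩, ?_, ?_, ?_⟩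
    · intro d d' e
      exact Subtype.ext (hinj _ d.2 _ d'.2 (congrArg Subtype.val e))
    · rintro ⟨r, hr⟩
      obtain ⟨d, hd, rfl⟩ := Finset.mem_image.1 hr
      exact ⟨⟨d, hd⟩, rfl⟩
    · refine hmax _ ?_ ?_
      · intro u hu u' hu' hne hp
        simp only [Set.Finite.coe_toFinset, Set.mem_ofPred_eq] at hu hu'
        exact hne (hp.eq_of_length (hu.trans hu'.symm))
      · intro y
        obtain ⟨u, w, hu, e⟩ := hsplit y
        exact ⟨u, by simpa using hu, w, e⟩
    · refine hmax _ ?_ ?_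
      · intro r hr r' hr' hne hp
        obtain ⟨u, hu, rfl⟩ := Finset.mem_image.1 (Finset.mem_coe.1 hr)
        obtain ⟨u', hu', rfl⟩ := Finset.mem_image.1 (Finset.mem_coe.1 hr')
        obtain ⟨s, hs⟩ := hp
        exact hne (congrArg v (key u u' s (by simpa using hu) (by simpa using hu') hs))
      · intro y
        obtain ⟨u, w, hu, e⟩ := hsplit (f.symm y)
        refine ⟨v u, Finset.mem_image_of_mem v (by simpa using hu), w, ?_⟩
        rw [← hv u hu, ← e, Equiv.apply_symm_apply]
    · rintro ⟨d, hd⟩ w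
      exact hv d (by simpa using hd) w

/-- Thompson's group `V`: the group of all prefix code maps of the Cantor set `{0,1}^ω`. -/
def ThompsonV : Subgroup (Equiv.Perm (Stream' Bool)) where
  carrier := {f | IsPrefixCodeMap f}
  one_mem' := (isPrefixCodeMap_iff 1).2 ⟨0, fun u _ => ⟨u, fun _ => rfl⟩⟩
  mul_mem' := by
    intro g f hg hf
    obtain ⟨N, hN⟩ := (isPrefixCodeMap_iff g).1 hg
    obtain ⟨M, hM⟩ := (isPrefixCodeMap_iff f).1 hf
    refine (isPrefixCodeMap_iff (g * f)).2 ⟨M + N, fun u hu => ?_⟩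
    obtain ⟨v, hv⟩ := hM (u.take M) (by simp [hu])
    have hl : N ≤ (v ++ u.drop M).length := by simp [hu]
    obtain ⟨z, hz⟩ := hN ((v ++ u.drop M).take N) (by simp only [List.length_take]; omega)
    refine ⟨z ++ (v ++ u.drop M).drop N, fun w => ?_⟩
    have e1 : f (u ++ₛ w) = (v ++ u.drop M) ++ₛ w := by
      conv_lhs => rw [← List.take_append_drop M u]
      rw [Stream'.append_append_stream, Stream'.append_append_stream, hv]
    rw [Equiv.Perm.mul_apply, e1]
    conv_lhs => rw [← List.take_append_drop N (v ++ u.drop M)]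
    rw [Stream'.append_append_stream, Stream'.append_append_stream, hz]
  inv_mem' := by
    rintro f ⟨D, R, σ, hD, hR, hf⟩
    refine ⟨R, D, σ.symm, hR, hD, fun r w => ?_⟩
    rw [Equiv.Perm.inv_eq_iff_eq, hf, Equiv.apply_symm_apply]

/-!
# Baumslag–Solitar groups in Thompson's group `V`

**Unequal exponents.** Let `x` be a fixed point of `A : V` near which `A` replaces a prefix `p` by
`p r`. The length of `r` measures the contraction of `A` at `x`; it is multiplied by `k` on passing
to `A ^ k`, and it does not change under conjugation in `V`. The contraction of `A ^ k` at any fixed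
point is at most a multiple of `k`, by a constant that depends on `A` only. If `b⁻¹ a ^ m b = a ^ n`
in `V` and `|m| ≠ |n|`, then iterating the relation turns a nonzero contraction of a power of `a`
into contractions that grow too fast (`eq_nil_of_conj_pow`), so that no power of `a` has one. But an
element of `V` without such points has finite order (`exists_pow_eq_one`): by a pigeonhole argument
on prefixes of bounded length, every point has a cone on which a power of the element is the
identity, and the Cantor set is compact. On the other hand `a` has infinite order in `BS(m, n)`, as
the action on `ℚ` by `a : x ↦ x + 1` and `b : x ↦ (m / n) x` shows.

**Equal exponents.** If `n = e m` with `e = ±1`, then `⟨a ^ m⟩` is normal in `BS(m, n)`, with quotient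
`ℤ * ℤ/m`, and `BS(m, n) → BS(1, e)` is injective on it; this gives the embedding into the product.
The free product acts faithfully on the Cantor set by ping-pong between its two halves
(`exists_coprod_zmod_injective`), the group `V × V` acts on the two halves separately
(`halvesHom_injective`), and `BS(1, e)` embeds in `V` as soon as `V` has an element of infinite order
that is conjugate to its `e`-th power (`BaumslagSolitar.exists_injective_thompsonV`).
-/

/-! ### Prefix replacement -/

/-- `f` replaces the prefix `u` by the prefix `v`: it maps the cone of infinite words starting with
`u` onto the cone of those starting with `v`, and leaves the remaining letters unchanged. -/
def ReplacesPrefix (f : Equiv.Perm (Stream' Bool)) (u v : List Bool) : Prop :=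
  ∀ w : Stream' Bool, f (u ++ₛ w) = v ++ₛ w

namespace ReplacesPrefix

variable {f g : Equiv.Perm (Stream' Bool)} {u v v' z : List Bool}

theorem one (u : List Bool) : ReplacesPrefix 1 u u := fun _ => rfl

theorem append (h : ReplacesPrefix f u v) (s : List Bool) :
    ReplacesPrefix f (u ++ s) (v ++ s) := fun w => by
  rw [Stream'.append_append_stream, Stream'.append_append_stream, h]

theorem mul (hg : ReplacesPrefix g v z) (hf : ReplacesPrefix f u v) :
    ReplacesPrefix (g * f) u z := fun w => by
  rw [Equiv.Perm.mul_apply, hf, hg]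

theorem inv (h : ReplacesPrefix f u v) : ReplacesPrefix f⁻¹ v u := fun w => by
  rw [Equiv.Perm.inv_eq_iff_eq, h]

/-- The image prefix is determined: `v w = (v s) w` for all infinite words `w` would force every `w`
to begin with `s`. -/
theorem unique (h : ReplacesPrefix f u v) (h' : ReplacesPrefix f u v') : v = v' := by
  have e : ∀ w : Stream' Bool, v ++ₛ w = v' ++ₛ w := fun w => (h w).symm.trans (h' w)
  clear h h'
  wlog hl : v.length ≤ v'.length generalizing v v'
  · exact (this (fun w => (e w).symm) (le_of_not_ge hl)).symm
  have e2 : v = v'.take v.length := by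
    have := e (Stream'.const true)
    rw [← List.take_append_drop v.length v', Stream'.append_append_stream] at this
    exact stream_append_inj (by simp [hl]) this
  obtain ⟨s, rfl⟩ : ∃ s, v' = v ++ s := ⟨v'.drop v.length, by
    conv_lhs => rw [← List.take_append_drop v.length v', ← e2]⟩
  cases s with
  | nil => simp
  | cons b s =>
    have := congrArg (Stream'.drop v.length) (e (Stream'.const (!b)))
    rw [Stream'.append_append_stream, Stream'.drop_append_stream, Stream'.drop_append_stream] at this
    have := congrArg Stream'.head this
    rw [Stream'.cons_append_stream, Stream'.head_cons] at this
    exact absurd this (by cases b <;> decide)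

/-- If `g ^ k` carries the cone of `u` to the cone of `v`, and some power of `g` is the identity on
the latter, then it is the identity on the former. -/
theorem pow_of_commute {j k : ℕ} (h : ReplacesPrefix (g ^ k) u v)
    (hv : ReplacesPrefix (g ^ j) v v) : ReplacesPrefix (g ^ j) u u := by
  have := h.inv.mul (hv.mul h)
  rwa [← pow_add, add_comm, pow_add, inv_mul_cancel_left] at this

theorem pow (h : ReplacesPrefix f u u) (k : ℕ) : ReplacesPrefix (f ^ k) u u := by
  induction k with
  | zero => exact one u
  | succ k ih => rw [pow_succ]; exact ih.mul h

end ReplacesPrefix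

theorem exists_replacesPrefix_of_mem {f : Equiv.Perm (Stream' Bool)} (hf : f ∈ ThompsonV) :
    ∃ N : ℕ, ∀ u : List Bool, N ≤ u.length → ∃ v, ReplacesPrefix f u v := by
  obtain ⟨N, hN⟩ := (isPrefixCodeMap_iff f).1 hf
  refine ⟨N, fun u hu => ?_⟩
  obtain ⟨v, hv⟩ := hN (u.take N) (by simp [hu])
  refine ⟨v ++ u.drop N, ?_⟩
  have := ReplacesPrefix.append hv (u.drop N)
  rwa [List.take_append_drop] at this

/-- Compactness of the Cantor set, as König's lemma: a property of cones that passes from the two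
halves of a cone to the cone, and holds for some neighbourhood of each point, holds for the whole
space. -/
theorem cone_induction {P : List Bool → Prop}
    (h : ∀ u, P (u ++ [false]) → P (u ++ [true]) → P u)
    (hx : ∀ x : Stream' Bool, ∃ n, P (x.take n)) : P [] := by
  by_contra h0
  have step : ∀ u : {u // ¬ P u}, ∃ b, ¬ P (u.1 ++ [b]) := by
    rintro ⟨u, hu⟩
    by_contra! hc
    exact hu (h u (hc false) (hc true))
  choose b hb using step
  let s : ℕ → {u // ¬ P u} := fun n => Nat.rec ⟨[], h0⟩ (fun _ u => ⟨u.1 ++ [b u], hb u⟩) n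
  let x : Stream' Bool := fun n => b (s n)
  obtain ⟨n, hn⟩ := hx x
  have key : ∀ n, x.take n = (s n).1 := by
    intro n
    induction n with
    | zero => rfl
    | succ n ih => rw [Stream'.take_succ', ih]; rfl
  rw [key] at hn
  exact (s n).2 hn

/-! ### Elements of finite order -/

/-- A word whose images under the powers of `g` are all defined and of length at least `N`. -/
def IsStableWord (g : Equiv.Perm (Stream' Bool)) (N : ℕ) (u : List Bool) : Prop :=
  ∀ k : ℕ, ∃ v : List Bool, N ≤ v.length ∧ ReplacesPrefix (g ^ k) u v

/-- If `g` has no attracting periodic point, then some power of `g` fixes the cone of a stable word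
pointwise. From a time on which the image words are never shorter again, only the first `N` letters
matter; two such times share these letters, and the power of `g` between them maps the cone of this
common prefix into itself. -/
theorem IsStableWord.exists_pow {g : Equiv.Perm (Stream' Bool)} {N : ℕ} {u : List Bool}
    (hu : IsStableWord g N u) (hN : ∀ p : List Bool, N ≤ p.length → ∃ q, ReplacesPrefix g p q)
    (hg : ∀ d : ℕ, 0 < d → ∀ p r, ReplacesPrefix (g ^ d) p (p ++ r) → r = []) :
    ∃ d : ℕ, 0 < d ∧ ReplacesPrefix (g ^ d) u u := by
  choose v hlen hv using hu
  let K : Set ℕ := {k | ∀ j, (v k).length ≤ (v (k + j)).length}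
  have hK : K.Infinite := by
    refine Set.infinite_of_forall_exists_gt fun T => ?_
    have hex : ∃ n, ∃ k > T, (v k).length = n := ⟨_, T + 1, by simp, rfl⟩
    classical
    obtain ⟨k, hkT, hk⟩ := Nat.find_spec hex
    exact ⟨k, fun j => hk ▸ Nat.find_min' hex ⟨k + j, by omega, rfl⟩, hkT⟩
  have claim : ∀ k ∈ K, ∀ j, ∃ q, N ≤ q.length ∧ ReplacesPrefix (g ^ j) ((v k).take N) q ∧
      v (k + j) = q ++ (v k).drop N := by
    intro k hk j
    induction j with
    | zero => exact ⟨_, by simp [hlen], ReplacesPrefix.one _, by simp⟩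
    | succ j ih =>
      obtain ⟨q, hq, hgq, hvq⟩ := ih
      obtain ⟨q', hq'⟩ := hN q hq
      have e : v (k + (j + 1)) = q' ++ (v k).drop N := by
        refine (hv (k + (j + 1))).unique ?_
        have := (hq'.append ((v k).drop N)).mul (hvq ▸ hv (k + j))
        rwa [← pow_succ', add_assoc] at this
      refine ⟨q', ?_, ?_, e⟩
      · have h1 := hk (j + 1)
        have h2 := hlen k
        rw [e, List.length_append, List.length_drop] at h1
        omega
      · rw [pow_succ']; exact hq'.mul hgq
  obtain ⟨k, hk, k', -, hne, heq, hlt⟩ : ∃ k ∈ K, ∃ k' ∈ K, k ≠ k' ∧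
      (v k).take N = (v k').take N ∧ k < k' := by
    obtain ⟨k, hk, k', hk', hne, he⟩ := hK.exists_ne_map_eq_of_mapsTo
      (f := fun k => (v k).take N) (t := {l | l.length = N}) (fun k _ => by simp [hlen])
      (List.finite_length_eq Bool N)
    rcases lt_or_gt_of_ne hne with h | h
    · exact ⟨k, hk, k', hk', hne, he, h⟩
    · exact ⟨k', hk', k, hk, hne.symm, he.symm, h⟩
  obtain ⟨q, hq, hgq, hvq⟩ := claim k hk (k' - k)
  rw [Nat.add_sub_cancel' hlt.le] at hvq
  have hqp : (v k).take N = q.take N := by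
    rw [heq, hvq, List.take_append_of_le_length hq]
  have hd : 0 < k' - k := by omega
  have hr : q.drop N = [] := by
    refine hg _ hd ((v k).take N) _ ?_
    rw [hqp, List.take_append_drop, ← hqp]
    exact hgq
  have hqq : q = (v k).take N := by
    rw [hqp]
    conv_lhs => rw [← List.take_append_drop N q, hr, List.append_nil]
  have hfix := hgq.append ((v k).drop N)
  rw [hqq, List.take_append_drop] at hfix
  exact ⟨k' - k, hd, (hv k).pow_of_commute hfix⟩

/-- If `g` has neither attracting nor repelling periodic points, then every point has a cone on
which some power of `g` is the identity. If no prefix of `x` is stable, then the orbit of `x` keeps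
reaching cones with a longer and longer stable past, and hence one that is stable for `g⁻¹`. -/
theorem exists_pow_replacesPrefix_take {g : Equiv.Perm (Stream' Bool)} (hgV : g ∈ ThompsonV)
    (hg : ∀ d : ℕ, 0 < d → ∀ p r, ReplacesPrefix (g ^ d) p (p ++ r) → r = [])
    (hg' : ∀ d : ℕ, 0 < d → ∀ p r, ReplacesPrefix (g⁻¹ ^ d) p (p ++ r) → r = [])
    (x : Stream' Bool) :
    ∃ n d : ℕ, 0 < d ∧ ReplacesPrefix (g ^ d) (x.take n) (x.take n) := by
  obtain ⟨N₁, hN₁⟩ := exists_replacesPrefix_of_mem hgV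
  obtain ⟨N₂, hN₂⟩ := exists_replacesPrefix_of_mem (inv_mem hgV)
  obtain ⟨N, hN, hN'⟩ : ∃ N, (∀ p : List Bool, N ≤ p.length → ∃ q, ReplacesPrefix g p q) ∧
      (∀ p : List Bool, N ≤ p.length → ∃ q, ReplacesPrefix g⁻¹ p q) :=
    ⟨max N₁ N₂, fun p hp => hN₁ p (le_trans (le_max_left _ _) hp),
      fun p hp => hN₂ p (le_trans (le_max_right _ _) hp)⟩
  by_cases hst : ∃ n, IsStableWord g N (x.take n)
  · obtain ⟨n, hn⟩ := hst
    exact ⟨n, hn.exists_pow hN hg⟩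
  have past : ∀ T : ℕ, ∃ p : {p : List Bool // p.length = N}, ∃ k ≥ T,
      (∀ j ≤ k, ∃ q : List Bool, N ≤ q.length ∧ ReplacesPrefix (g⁻¹ ^ j) p.1 q) ∧
      ∃ n, ReplacesPrefix (g ^ k) (x.take n) p.1 := by
    intro T
    have hL : ∀ᶠ L in Filter.atTop, ∀ j ∈ Set.Iic T,
        ∃ v : List Bool, N ≤ v.length ∧ ReplacesPrefix (g ^ j) (x.take L) v := by
      refine (Filter.eventually_all_finite (Set.finite_Iic T)).2 fun j _ => ?_
      obtain ⟨M, hM⟩ := exists_replacesPrefix_of_mem (pow_mem hgV j)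
      filter_upwards [Filter.eventually_ge_atTop (M + N)] with L hL
      obtain ⟨v, hv⟩ := hM (x.take M) (by simp)
      have := hv.append ((x.drop M).take (L - M))
      rw [← Stream'.take_add, Nat.add_sub_cancel' (by omega)] at this
      exact ⟨_, by rw [List.length_append, Stream'.length_take]; omega, this⟩
    obtain ⟨L, hL⟩ := hL.exists
    have hns : ∃ k, ¬ ∃ v : List Bool, N ≤ v.length ∧ ReplacesPrefix (g ^ k) (x.take L) v := by
      by_contra! hc
      exact hst ⟨L, hc⟩
    classical
    obtain ⟨k, hk, hmin⟩ : ∃ k,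
        (¬ ∃ v : List Bool, N ≤ v.length ∧ ReplacesPrefix (g ^ k) (x.take L) v) ∧
        ∀ j < k, ∃ v : List Bool, N ≤ v.length ∧ ReplacesPrefix (g ^ j) (x.take L) v :=
      ⟨Nat.find hns, Nat.find_spec hns, fun j hj => not_not.1 (Nat.find_min hns hj)⟩
    have hTk : T < k := by
      by_contra hc
      exact hk (hL k (not_lt.1 hc))
    obtain ⟨k, rfl⟩ : ∃ k', k = k' + 1 := ⟨k - 1, by omega⟩
    obtain ⟨v, hv, hgv⟩ := hmin k (by omega)
    obtain ⟨z, hz⟩ := hN v hv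
    have hgz := hz.mul hgv
    rw [← pow_succ'] at hgz
    have hzN : z.length < N := by
      by_contra hc
      exact hk ⟨z, not_lt.1 hc, hgz⟩
    -- The image first gets too short at time `k + 1`; extend the word to make its length `N` there.
    set e := (x.drop L).take (N - z.length) with he
    have hel : (z ++ e).length = N := by
      rw [List.length_append, he, Stream'.length_take]; omega
    have hge := hgz.append e
    refine ⟨⟨z ++ e, hel⟩, k + 1, hTk.le, fun j hj => ?_, L + (N - z.length), ?_⟩
    · rcases Nat.eq_zero_or_pos j with rfl | hj0
      · exact ⟨z ++ e, hel.ge, ReplacesPrefix.one _⟩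
      · obtain ⟨q, hq, hgq⟩ := hmin (k + 1 - j) (by omega)
        refine ⟨q ++ e, by rw [List.length_append]; omega, ?_⟩
        have := (hgq.append e).mul hge.inv
        have e1 : g ^ (k + 1) = g ^ j * g ^ (k + 1 - j) := by
          rw [← pow_add, Nat.add_sub_cancel' hj]
        rwa [e1, mul_inv_rev, mul_inv_cancel_left, ← inv_pow] at this
    · rw [Stream'.take_add]; exact hge
  choose p k hk hpast hn using past
  have : Finite {p : List Bool // p.length = N} := List.finite_length_eq Bool N
  obtain ⟨p₀, hp₀⟩ := Finite.exists_infinite_fiber p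
  rw [Set.infinite_coe_iff] at hp₀
  have hstab : IsStableWord g⁻¹ N p₀.1 := by
    intro j
    obtain ⟨T, hT, hjT⟩ := hp₀.exists_gt j
    obtain rfl : p T = p₀ := hT
    exact hpast T j (hjT.le.trans (hk T))
  obtain ⟨d, hd, hfix⟩ := hstab.exists_pow hN' hg'
  obtain ⟨T, hT⟩ := hp₀.nonempty
  obtain rfl : p T = p₀ := hT
  obtain ⟨n, hn⟩ := hn T
  refine ⟨n, d, hd, hn.pow_of_commute ?_⟩
  have := hfix.inv
  rwa [inv_pow, inv_inv] at this

/-- An element of `V` without attracting or repelling periodic points has finite order. -/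
theorem exists_pow_eq_one {g : Equiv.Perm (Stream' Bool)} (hgV : g ∈ ThompsonV)
    (hg : ∀ d : ℤ, d ≠ 0 → ∀ p r, ReplacesPrefix (g ^ d) p (p ++ r) → r = []) :
    ∃ d : ℕ, 0 < d ∧ g ^ d = 1 := by
  have key : ∃ d : ℕ, 0 < d ∧ ReplacesPrefix (g ^ d) [] [] := by
    refine cone_induction (P := fun u => ∃ d : ℕ, 0 < d ∧ ReplacesPrefix (g ^ d) u u) ?_ ?_
    · rintro u ⟨d, hd, h⟩ ⟨d', hd', h'⟩
      refine ⟨d * d', by positivity, fun w => ?_⟩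
      have h1 := h.pow d'
      have h2 := h'.pow d
      rw [← pow_mul] at h1
      rw [← pow_mul, mul_comm] at h2
      have hw : w = [w.head] ++ₛ w.tail := (Stream'.append_stream_head_tail w).symm
      rw [hw, ← Stream'.append_append_stream]
      cases w.head
      · exact h1 _
      · exact h2 _
    · refine fun x => exists_pow_replacesPrefix_take hgV (fun d hd p r h => ?_)
        (fun d hd p r h => ?_) x
      · exact hg d (by omega) p r (by rwa [zpow_natCast])
      · exact hg (-d) (by omega) p r (by rwa [zpow_neg, zpow_natCast, ← inv_pow])
  obtain ⟨d, hd, h⟩ := key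
  exact ⟨d, hd, Equiv.ext fun w => h w⟩

/-! ### Conjugate powers -/

/-- The `k`-th power of an element of `V` lengthens prefixes by at most a multiple of `k`. -/
theorem exists_length_le {A : Equiv.Perm (Stream' Bool)} (hA : A ∈ ThompsonV) :
    ∃ D : ℕ, ∀ k : ℕ, ∀ v v' : List Bool, ReplacesPrefix (A ^ k) v v' →
      v'.length ≤ v.length + k * D := by
  obtain ⟨N, hN⟩ := exists_replacesPrefix_of_mem hA
  choose! q hq using hN
  obtain ⟨D, hD⟩ : ∃ D, ∀ u : List Bool, u.length = N → (q u).length ≤ D := by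
    obtain ⟨D, hD⟩ := ((List.finite_length_eq Bool N).image fun u => (q u).length).bddAbove
    exact ⟨D, fun u hu => hD ⟨u, hu, rfl⟩⟩
  have one : ∀ v v', ReplacesPrefix A v v' → v'.length ≤ v.length + D := by
    intro v v' h
    have h1 := h.append (List.replicate N true)
    set s := v ++ List.replicate N true with hs
    have hsl : s.length = v.length + N := by simp [hs]
    have h2 := (hq (s.take N) (by simp [hsl])).append (s.drop N)
    rw [List.take_append_drop] at h2
    have h3 := congrArg List.length (h1.unique h2)
    have h4 := hD (s.take N) (by simp [hsl])
    simp only [List.length_append, List.length_replicate, List.length_drop] at h3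
    omega
  refine ⟨D, fun k => ?_⟩
  induction k with
  | zero => intro v v' h; rw [h.unique (ReplacesPrefix.one v)]; simp
  | succ k ih =>
    intro v v' h
    obtain ⟨M, hM⟩ := exists_replacesPrefix_of_mem (pow_mem hA k)
    obtain ⟨z, hz⟩ := hM (v ++ List.replicate M true) (by simp)
    have h1 := (h.append (List.replicate M true)).mul hz.inv
    rw [pow_succ', mul_inv_cancel_right] at h1
    have h2 := one _ _ h1
    have h3 := ih _ _ hz
    simp only [List.length_append, List.length_replicate] at h2 h3
    rw [Nat.succ_mul]
    omega

theorem ReplacesPrefix.pow_append_flatten {A : Equiv.Perm (Stream' Bool)} {p r : List Bool}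
    (h : ReplacesPrefix A p (p ++ r)) (k : ℕ) :
    ReplacesPrefix (A ^ k) p (p ++ (List.replicate k r).flatten) := by
  induction k with
  | zero => simpa using ReplacesPrefix.one p
  | succ k ih =>
    rw [pow_succ', List.replicate_succ, List.flatten_cons, ← List.append_assoc]
    exact (h.append _).mul ih

/-- If `f` conjugates `A ^ M` to `A ^ N` with `N < M`, then `A` has no attracting fixed point:
conjugation by `f ^ j` turns `A ^ M ^ j`, whose contraction at the fixed point is `M ^ j` times that
of `A`, into `A ^ N ^ j`, whose contraction is at most a multiple of `N ^ j`. -/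
theorem eq_nil_of_conj_pow {A f : Equiv.Perm (Stream' Bool)} (hA : A ∈ ThompsonV)
    (hf : f ∈ ThompsonV) {M N : ℕ} (hMN : N < M) (h : f * A ^ M * f⁻¹ = A ^ N)
    {p r : List Bool} (hpr : ReplacesPrefix A p (p ++ r)) : r = [] := by
  by_contra hr
  have hr1 : 1 ≤ r.length := List.length_pos_iff.2 hr
  obtain ⟨D, hD⟩ := exists_length_le hA
  have hconj : ∀ j : ℕ, f ^ j * A ^ M ^ j * (f ^ j)⁻¹ = A ^ N ^ j := by
    intro j
    induction j with
    | zero => simp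
    | succ j ih =>
      have h1 : f * A ^ M ^ (j + 1) * f⁻¹ = (A ^ M ^ j) ^ N := by
        rw [pow_succ, mul_comm, pow_mul, ← conj_pow, h, ← pow_mul, ← pow_mul, mul_comm]
      calc f ^ (j + 1) * A ^ M ^ (j + 1) * (f ^ (j + 1))⁻¹
          = f ^ j * (f * A ^ M ^ (j + 1) * f⁻¹) * (f ^ j)⁻¹ := by rw [pow_succ f j]; group
        _ = A ^ N ^ (j + 1) := by rw [h1, ← conj_pow, ih, ← pow_mul, ← pow_succ]
  have hbound : ∀ j : ℕ, M ^ j ≤ N ^ j * D := by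
    intro j
    obtain ⟨L, hL⟩ := exists_replacesPrefix_of_mem (pow_mem hf j)
    -- A prefix of the fixed point `p r r r ⋯` long enough for `f ^ j` to replace it.
    obtain ⟨v, hv⟩ := hL (p ++ (List.replicate L r).flatten) (by
      simp only [List.length_append, List.length_flatten, List.map_replicate, List.sum_replicate,
        smul_eq_mul]
      nlinarith)
    have h1 : ReplacesPrefix (A ^ M ^ j) (p ++ (List.replicate L r).flatten)
        (p ++ (List.replicate L r).flatten ++ (List.replicate (M ^ j) r).flatten) := by
      have := (hpr.pow_append_flatten (M ^ j)).append (List.replicate L r).flatten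
      rwa [List.append_assoc, ← List.flatten_append, List.replicate_append_replicate, add_comm,
        ← List.replicate_append_replicate, List.flatten_append, ← List.append_assoc] at this
    have h2 := ((hv.append _).mul h1).mul hv.inv
    rw [hconj] at h2
    have h3 := hD _ _ _ h2
    simp only [List.length_append, List.length_flatten, List.map_replicate, List.sum_replicate,
      smul_eq_mul] at h3
    nlinarith [Nat.zero_le (M ^ j)]
  have hM0 : (0 : ℝ) < M := by exact_mod_cast (Nat.zero_le N).trans_lt hMN
  rcases Nat.eq_zero_or_pos N with rfl | hN0
  · have := hbound 1
    simp at this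
    omega
  · have hN0' : (0 : ℝ) < N := by exact_mod_cast hN0
    obtain ⟨j, hj⟩ := pow_unbounded_of_one_lt (D : ℝ)
      (show (1 : ℝ) < M / N by rw [one_lt_div hN0']; exact_mod_cast hMN)
    rw [div_pow, lt_div_iff₀ (by positivity)] at hj
    have : (M : ℝ) ^ j ≤ N ^ j * D := by exact_mod_cast hbound j
    linarith

/-! ### Elements of `V` from complete codes -/

/-- The cones of the words `c k`, for `k : κ`, partition the Cantor set. -/
def IsConeCode {κ : Type} (c : κ → List Bool) : Prop :=
  Function.Bijective fun p : κ × Stream' Bool => c p.1 ++ₛ p.2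

namespace IsConeCode

variable {κ : Type} {c c' : κ → List Bool}

theorem exists_eq (hc : IsConeCode c) (x : Stream' Bool) : ∃ k w, x = c k ++ₛ w := by
  obtain ⟨⟨k, w⟩, h⟩ := hc.2 x
  exact ⟨k, w, h.symm⟩

/-- A permutation that replaces the prefixes in a complete code lies in `V`. -/
theorem mem_thompsonV (hc : IsConeCode c) {f : Equiv.Perm (Stream' Bool)}
    (hf : ∀ k, ∃ v, ReplacesPrefix f (c k) v) : f ∈ ThompsonV := by
  refine (isPrefixCodeMap_iff f).2 ?_
  have : ∃ N : ℕ, ∀ s : List Bool, N ≤ s.length → ∃ v, ReplacesPrefix f ([] ++ s) v := by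
    refine cone_induction
      (P := fun u => ∃ N : ℕ, ∀ s : List Bool, N ≤ s.length → ∃ v, ReplacesPrefix f (u ++ s) v)
      ?_ ?_
    · rintro u ⟨N, hN⟩ ⟨N', hN'⟩
      refine ⟨max N N' + 1, fun s hs => ?_⟩
      rcases s with _ | ⟨b, s⟩
      · simp at hs
      · simp only [List.length_cons, Nat.add_le_add_iff_right, max_le_iff] at hs
        cases b
        · simpa using hN s hs.1
        · simpa using hN' s hs.2
    · intro x
      obtain ⟨k, w, rfl⟩ := hc.exists_eq x
      refine ⟨(c k).length, 0, fun s _ => ?_⟩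
      obtain ⟨v, hv⟩ := hf k
      rw [Stream'.take_append_of_le_length _ _ _ le_rfl, List.take_length]
      exact ⟨_, hv.append s⟩
  obtain ⟨N, hN⟩ := this
  exact ⟨N, fun u hu => hN u hu.ge⟩

theorem ofBijective_symm_trans_apply (hc : IsConeCode c) (hc' : IsConeCode c') (k : κ)
    (w : Stream' Bool) :
    (Equiv.ofBijective _ hc).symm.trans (Equiv.ofBijective _ hc') (c k ++ₛ w) = c' k ++ₛ w := by
  have : (Equiv.ofBijective _ hc).symm (c k ++ₛ w) = (k, w) :=
    (Equiv.symm_apply_eq _).2 rfl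
  rw [Equiv.trans_apply, this]
  rfl

/-- The element of `V` that replaces the prefix `c k` by `c' k`, for each `k`. -/
noncomputable def prefixMap (hc : IsConeCode c) (hc' : IsConeCode c') : ThompsonV :=
  ⟨(Equiv.ofBijective _ hc).symm.trans (Equiv.ofBijective _ hc'),
    hc.mem_thompsonV fun k => ⟨c' k, hc.ofBijective_symm_trans_apply hc' k⟩⟩

theorem prefixMap_apply (hc : IsConeCode c) (hc' : IsConeCode c') (k : κ) (w : Stream' Bool) :
    (hc.prefixMap hc').1 (c k ++ₛ w) = c' k ++ₛ w :=
  hc.ofBijective_symm_trans_apply hc' k w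

theorem comp_perm (hc : IsConeCode c) (σ : Equiv.Perm κ) : IsConeCode (c ∘ σ) :=
  hc.comp (σ.prodCongr (Equiv.refl _)).bijective

/-- The symmetric group on the index set of a complete code, permuting the cones. -/
noncomputable def permHom (hc : IsConeCode c) : Equiv.Perm κ →* ThompsonV where
  toFun σ := hc.prefixMap (hc.comp_perm σ)
  map_one' := by
    refine Subtype.ext (Equiv.ext fun x => ?_)
    obtain ⟨k, w, rfl⟩ := hc.exists_eq x
    exact hc.prefixMap_apply _ k w
  map_mul' σ τ := by
    refine Subtype.ext (Equiv.ext fun x => ?_)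
    obtain ⟨k, w, rfl⟩ := hc.exists_eq x
    rw [prefixMap_apply, Subgroup.coe_mul, Equiv.Perm.mul_apply, prefixMap_apply]
    exact (hc.prefixMap_apply (hc.comp_perm σ) (τ k) w).symm

theorem permHom_apply (hc : IsConeCode c) (σ : Equiv.Perm κ) (k : κ) (w : Stream' Bool) :
    (hc.permHom σ).1 (c k ++ₛ w) = c (σ k) ++ₛ w :=
  hc.prefixMap_apply (hc.comp_perm σ) k w

/-- A complete code in which `k₀` gets the half `true` of the Cantor set and the other indices share
the half `false`. -/
theorem extend [DecidableEq κ] (k₀ : κ) {d : {k // k ≠ k₀} → List Bool} (hd : IsConeCode d) :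
    IsConeCode fun k => if h : k = k₀ then [true] else false :: d ⟨k, h⟩ := by
  constructor
  · rintro ⟨k, w⟩ ⟨l, z⟩ h
    by_cases hk : k = k₀ <;> by_cases hl : l = k₀ <;>
      simp only [hk, hl, dite_true, dite_false, Stream'.cons_append_stream,
        Stream'.nil_append_stream] at h
    · rw [hk, hl, (Stream'.cons_injective2 h).2]
    · exact absurd (Stream'.cons_injective2 h).1 (by decide)
    · exact absurd (Stream'.cons_injective2 h).1 (by decide)
    · have := @hd.1 (⟨k, hk⟩, w) (⟨l, hl⟩, z) (Stream'.cons_injective2 h).2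
      simpa using this
  · intro x
    rw [← Stream'.append_stream_head_tail x]
    cases x.head
    · obtain ⟨⟨k, hk⟩, w, h⟩ := hd.exists_eq x.tail
      refine ⟨(k, w), ?_⟩
      simp [hk, h, Stream'.cons_append_stream]
    · exact ⟨(k₀, x.tail), by simp⟩

end IsConeCode

theorem exists_isConeCode (κ : Type) [Finite κ] [Nonempty κ] :
    ∃ c : κ → List Bool, IsConeCode c := by
  obtain ⟨n, hn⟩ : ∃ n, Nat.card κ = n + 1 :=
    ⟨Nat.card κ - 1, by have := Nat.card_pos (α := κ); omega⟩
  induction n generalizing κ with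
  | zero =>
    have : Subsingleton κ := (Nat.card_eq_one_iff_unique.1 hn).1
    refine ⟨fun _ => [], fun p q h => Prod.ext (Subsingleton.elim _ _) h, fun x => ?_⟩
    exact ⟨(Classical.arbitrary κ, x), rfl⟩
  | succ n ih =>
    classical
    let k₀ := Classical.arbitrary κ
    have h1 : Nat.card {k // k ≠ k₀} = n + 1 := by
      have := Nat.card_congr (Equiv.optionSubtypeNe k₀)
      rw [Finite.card_option] at this
      omega
    have : Nonempty {k // k ≠ k₀} := (Nat.card_pos_iff.1 (by omega)).1
    obtain ⟨d, hd⟩ := ih {k // k ≠ k₀} h1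
    exact ⟨_, hd.extend k₀⟩

/-! ### The subgroup `V × V` -/

/-- The permutation that acts as `f` on the half `false` of the Cantor set and as `g` on the half
`true`. -/
def halvesPerm (f g : Equiv.Perm (Stream' Bool)) : Equiv.Perm (Stream' Bool) where
  toFun x := Stream'.cons x.head (bif x.head then g x.tail else f x.tail)
  invFun x := Stream'.cons x.head (bif x.head then g.symm x.tail else f.symm x.tail)
  left_inv x := by
    conv_rhs => rw [← Stream'.eta x]
    dsimp only
    rw [Stream'.head_cons, Stream'.tail_cons]
    cases x.head <;> simp
  right_inv x := by
    conv_rhs => rw [← Stream'.eta x]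
    dsimp only
    rw [Stream'.head_cons, Stream'.tail_cons]
    cases x.head <;> simp

theorem halvesPerm_mem {f g : Equiv.Perm (Stream' Bool)} (hf : f ∈ ThompsonV)
    (hg : g ∈ ThompsonV) : halvesPerm f g ∈ ThompsonV := by
  obtain ⟨N, hN⟩ := exists_replacesPrefix_of_mem hf
  obtain ⟨M, hM⟩ := exists_replacesPrefix_of_mem hg
  refine (isPrefixCodeMap_iff _).2 ⟨max N M + 1, fun u hu => ?_⟩
  rcases u with _ | ⟨b, u⟩
  · simp at hu
  · have hu' : u.length = max N M := by simpa using hu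
    cases b
    · obtain ⟨v, hv⟩ := hN u (hu' ▸ le_max_left _ _)
      exact ⟨false :: v, fun w => congrArg (Stream'.cons false) (hv w)⟩
    · obtain ⟨v, hv⟩ := hM u (hu' ▸ le_max_right _ _)
      exact ⟨true :: v, fun w => congrArg (Stream'.cons true) (hv w)⟩

/-- The embedding `V × V → V` that lets the factors act on the two halves of the Cantor set. -/
def halvesHom : ThompsonV × ThompsonV →* ThompsonV where
  toFun p := ⟨halvesPerm p.1.1 p.2.1, halvesPerm_mem p.1.2 p.2.2⟩
  map_one' := by
    refine Subtype.ext (Equiv.ext fun x => ?_)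
    rw [← Stream'.eta x]
    cases x.head <;> rfl
  map_mul' p q := by
    refine Subtype.ext (Equiv.ext fun x => ?_)
    rw [← Stream'.eta x]
    cases x.head <;> rfl

theorem halvesHom_apply (p : ThompsonV × ThompsonV) (b : Bool) (x : Stream' Bool) :
    (halvesHom p).1 (Stream'.cons b x) = Stream'.cons b (bif b then p.2.1 x else p.1.1 x) := rfl

theorem halvesHom_injective : Function.Injective halvesHom := by
  intro p q h
  have h' : ∀ b x, (halvesHom p).1 (Stream'.cons b x) = (halvesHom q).1 (Stream'.cons b x) :=
    fun b x => by rw [h]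
  refine Prod.ext (Subtype.ext (Equiv.ext fun x => ?_)) (Subtype.ext (Equiv.ext fun x => ?_))
  · exact (Stream'.cons_injective2 (h' false x)).2
  · exact (Stream'.cons_injective2 (h' true x)).2

theorem isConeCode_bool : IsConeCode fun b : Bool => [b] := by
  constructor
  · rintro ⟨b, x⟩ ⟨c, y⟩ h
    obtain ⟨h1, h2⟩ := Stream'.cons_injective2 h
    exact Prod.ext h1 h2
  · exact fun x => ⟨(x.head, x.tail), Stream'.eta x⟩

/-- The element of `V` that interchanges the two halves of the Cantor set. -/
noncomputable def halvesSwap : ThompsonV := isConeCode_bool.permHom Equiv.boolNot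

theorem halvesSwap_apply (b : Bool) (x : Stream' Bool) :
    halvesSwap.1 (Stream'.cons b x) = Stream'.cons (!b) x :=
  isConeCode_bool.permHom_apply Equiv.boolNot b x

theorem halvesSwap_inv : halvesSwap⁻¹ = halvesSwap := by
  refine inv_eq_of_mul_eq_one_left (Subtype.ext (Equiv.ext fun x => ?_))
  rw [← Stream'.eta x, Subgroup.coe_mul, Equiv.Perm.mul_apply, halvesSwap_apply, halvesSwap_apply,
    Bool.not_not]
  rfl

theorem halvesSwap_conj (f g : ThompsonV) :
    halvesSwap⁻¹ * halvesHom (f, g) * halvesSwap = halvesHom (g, f) := by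
  rw [halvesSwap_inv]
  refine Subtype.ext (Equiv.ext fun x => ?_)
  rw [← Stream'.eta x, Subgroup.coe_mul, Subgroup.coe_mul, Equiv.Perm.mul_apply,
    Equiv.Perm.mul_apply, halvesSwap_apply, halvesHom_apply, halvesSwap_apply, halvesHom_apply]
  cases x.head <;> rfl

/-! ### Free products in `V` -/

/-- The family of two groups, to regard a binary free product as an indexed one. -/
def pairFamily (G₁ G₂ : Type) : Bool → Type
  | true => G₁
  | false => G₂

instance {G₁ G₂ : Type} [Group G₁] [Group G₂] : ∀ b, Group (pairFamily G₁ G₂ b)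
  | true => ‹Group G₁›
  | false => ‹Group G₂›

/-- The ping-pong lemma for a free product of two groups. -/
theorem coprod_lift_injective_of_ping_pong {G₁ G₂ G α : Type} [Group G₁] [Group G₂] [Group G]
    [MulAction G α] (f : G₁ →* G) (g : G₂ →* G) (hcard : 3 ≤ Cardinal.mk G₁) (X Y : Set α)
    (hX : X.Nonempty) (hY : Y.Nonempty) (hXY : Disjoint X Y)
    (hf : ∀ h : G₁, h ≠ 1 → Set.MapsTo (f h • ·) Y X)
    (hg : ∀ h : G₂, h ≠ 1 → Set.MapsTo (g h • ·) X Y) :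
    Function.Injective (Monoid.Coprod.lift f g) := by
  let F : ∀ b, pairFamily G₁ G₂ b →* G
    | true => f
    | false => g
  let I : ∀ b, pairFamily G₁ G₂ b →* Monoid.Coprod G₁ G₂
    | true => Monoid.Coprod.inl
    | false => Monoid.Coprod.inr
  let i₁ : G₁ →* Monoid.CoprodI (pairFamily G₁ G₂) :=
    Monoid.CoprodI.of (M := pairFamily G₁ G₂) (i := true)
  let i₂ : G₂ →* Monoid.CoprodI (pairFamily G₁ G₂) :=
    Monoid.CoprodI.of (M := pairFamily G₁ G₂) (i := false)
  have hinv : (Monoid.CoprodI.lift I).comp (Monoid.Coprod.lift i₁ i₂) = MonoidHom.id _ := by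
    refine Monoid.Coprod.hom_ext (MonoidHom.ext fun x => ?_) (MonoidHom.ext fun x => ?_)
    · exact Monoid.CoprodI.lift_of I (i := true) x
    · exact Monoid.CoprodI.lift_of I (i := false) x
  have hlift : Monoid.Coprod.lift f g =
      (Monoid.CoprodI.lift F).comp (Monoid.Coprod.lift i₁ i₂) := by
    refine Monoid.Coprod.hom_ext (MonoidHom.ext fun x => ?_) (MonoidHom.ext fun x => ?_)
    · exact (Monoid.CoprodI.lift_of F (i := true) x).symm
    · exact (Monoid.CoprodI.lift_of F (i := false) x).symm
  have h1 : Function.Injective (Monoid.CoprodI.lift F) := by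
    refine Monoid.CoprodI.lift_injective_of_ping_pong F (Or.inr ⟨true, hcard⟩)
      (fun b => bif b then X else Y) ?_ ?_ ?_
    · rintro (_ | _) <;> assumption
    · rintro (_ | _) (_ | _) h
      · exact absurd rfl h
      · exact hXY.symm
      · exact hXY
      · exact absurd rfl h
    · rintro (_ | _) (_ | _) h
      · exact absurd rfl h
      · exact fun h hh => (hg h hh).image_subset
      · exact fun h hh => (hf h hh).image_subset
      · exact absurd rfl h
  rw [hlift, MonoidHom.coe_comp]
  exact h1.comp (Function.LeftInverse.injective (DFunLike.congr_fun hinv))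

/-- The domain of the prefix replacements `100 ↦ 10`, `101 ↦ 0`, `0 ↦ 110`, `11 ↦ 111`, which
define the infinite-order factor of the free product. -/
def pingCode : Fin 4 → List Bool :=
  ![[true, false, false], [true, false, true], [false], [true, true]]

/-- The range of the prefix replacements with domain `pingCode`. -/
def pongCode : Fin 4 → List Bool :=
  ![[true, false], [false], [true, true, false], [true, true, true]]

theorem isConeCode_pingCode : IsConeCode pingCode := by
  constructor
  · rintro ⟨i, x⟩ ⟨j, y⟩ h
    fin_cases i <;> fin_cases j <;>
      simp [pingCode, Stream'.cons_append_stream, Stream'.cons_injective2.eq_iff] at h ⊢ <;>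
      exact h
  · intro x
    rw [← Stream'.append_take_drop 3 x]
    generalize x.drop 3 = w
    simp only [Stream'.take_succ, Stream'.take_zero]
    rcases x.head with _ | _
    · exact ⟨(2, [x.tail.head, x.tail.tail.head] ++ₛ w), rfl⟩
    rcases x.tail.head with _ | _
    · rcases x.tail.tail.head with _ | _
      · exact ⟨(0, w), rfl⟩
      · exact ⟨(1, w), rfl⟩
    · exact ⟨(3, [x.tail.tail.head] ++ₛ w), rfl⟩

theorem isConeCode_pongCode : IsConeCode pongCode := by
  constructor
  · rintro ⟨i, x⟩ ⟨j, y⟩ h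
    fin_cases i <;> fin_cases j <;>
      simp [pongCode, Stream'.cons_append_stream, Stream'.cons_injective2.eq_iff] at h ⊢ <;>
      exact h
  · intro x
    rw [← Stream'.append_take_drop 3 x]
    generalize x.drop 3 = w
    simp only [Stream'.take_succ, Stream'.take_zero]
    rcases x.head with _ | _
    · exact ⟨(1, [x.tail.head, x.tail.tail.head] ++ₛ w), rfl⟩
    rcases x.tail.head with _ | _
    · exact ⟨(0, [x.tail.tail.head] ++ₛ w), rfl⟩
    · rcases x.tail.tail.head with _ | _
      · exact ⟨(2, w), rfl⟩
      · exact ⟨(3, w), rfl⟩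

/-- An element of `V` all of whose nontrivial powers map the half `false` of the Cantor set into the
half `true`: positive powers map it into the cone of `11`, negative ones into the cone of `10`. -/
noncomputable def pingPongElement : ThompsonV :=
  isConeCode_pingCode.prefixMap isConeCode_pongCode

theorem pingPongElement_replacesPrefix (i : Fin 4) :
    ReplacesPrefix pingPongElement.1 (pingCode i) (pongCode i) :=
  isConeCode_pingCode.prefixMap_apply isConeCode_pongCode i

theorem pingPongElement_pow (k : ℕ) :
    ∃ v, ReplacesPrefix (pingPongElement ^ (k + 1)).1 [false] ([true] ++ v) := by
  suffices h : ∃ v, ReplacesPrefix (pingPongElement ^ (k + 1)).1 [false] ([true, true] ++ v) by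
    obtain ⟨v, hv⟩ := h
    exact ⟨true :: v, hv⟩
  induction k with
  | zero => exact ⟨[false], by rw [zero_add, pow_one]; exact pingPongElement_replacesPrefix 2⟩
  | succ k ih =>
    obtain ⟨v, hv⟩ := ih
    rw [pow_succ']
    exact ⟨true :: v, ((pingPongElement_replacesPrefix 3).append v).mul hv⟩

theorem pingPongElement_inv_pow (k : ℕ) :
    ∃ v, ReplacesPrefix (pingPongElement⁻¹ ^ (k + 1)).1 [false] ([true] ++ v) := by
  suffices h : ∃ v, ReplacesPrefix (pingPongElement⁻¹ ^ (k + 1)).1 [false] ([true, false] ++ v) by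
    obtain ⟨v, hv⟩ := h
    exact ⟨false :: v, hv⟩
  induction k with
  | zero => exact ⟨[true], by rw [zero_add, pow_one]; exact (pingPongElement_replacesPrefix 1).inv⟩
  | succ k ih =>
    obtain ⟨v, hv⟩ := ih
    rw [pow_succ']
    exact ⟨false :: v, ((pingPongElement_replacesPrefix 0).inv.append v).mul hv⟩

theorem pingPongElement_zpow {k : ℤ} (hk : k ≠ 0) :
    ∃ v, ReplacesPrefix (pingPongElement ^ k).1 [false] ([true] ++ v) := by
  obtain ⟨n, rfl | rfl⟩ := k.eq_nat_or_neg
  · obtain ⟨j, rfl⟩ : ∃ j, n = j + 1 := ⟨n - 1, by omega⟩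
    rw [zpow_natCast]
    exact pingPongElement_pow j
  · obtain ⟨j, rfl⟩ : ∃ j, n = j + 1 := ⟨n - 1, by omega⟩
    rw [zpow_neg, zpow_natCast, ← inv_pow]
    exact pingPongElement_inv_pow j

theorem pingPongElement_zpow_ne_one {k : ℤ} (hk : k ≠ 0) : pingPongElement ^ k ≠ 1 := by
  intro h
  obtain ⟨v, hv⟩ := pingPongElement_zpow hk
  rw [h] at hv
  exact absurd (hv.unique (ReplacesPrefix.one _)) (by simp)

/-- Translations of `ZMod k` acting on the first factor of `ZMod k × Bool`. The second factor makes
sure that there are at least two indices. -/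
def translationHom (k : ℕ) : Multiplicative (ZMod k) →* Equiv.Perm (ZMod k × Bool) where
  toFun j := (Equiv.addLeft j.toAdd).prodCongr (Equiv.refl Bool)
  map_one' := Equiv.ext fun p => Prod.ext (zero_add p.1) rfl
  map_mul' i j := Equiv.ext fun p => Prod.ext (add_assoc i.toAdd j.toAdd p.1) rfl

/-- `ℤ * ℤ/k` embeds in `V`: the nontrivial elements of the cyclic group of order `k` can be chosen
to map the half `true` of the Cantor set, as one of the cones that they permute freely, into the
half `false`. -/
theorem exists_coprod_zmod_injective {k : ℕ} (hk : k ≠ 0) :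
    ∃ α : Monoid.Coprod (Multiplicative ℤ) (Multiplicative (ZMod k)) →* ThompsonV,
      Function.Injective α := by
  have : NeZero k := ⟨hk⟩
  have : Nonempty {p : ZMod k × Bool // p ≠ (0, true)} := ⟨⟨(0, false), by simp⟩⟩
  obtain ⟨d, hd⟩ := exists_isConeCode {p : ZMod k × Bool // p ≠ (0, true)}
  have hc := hd.extend (0, true)
  refine ⟨Monoid.Coprod.lift (zpowersHom ThompsonV pingPongElement)
    (hc.permHom.comp (translationHom k)), ?_⟩
  refine coprod_lift_injective_of_ping_pong (α := Stream' Bool) _ _ ?_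
    (Set.range (Stream'.cons true)) (Set.range (Stream'.cons false)) ⟨_, ⟨Stream'.const true, rfl⟩⟩
    ⟨_, ⟨Stream'.const true, rfl⟩⟩ ?_ ?_ ?_
  · exact (Cardinal.natCast_lt_aleph0 (n := 3)).le.trans (Cardinal.aleph0_le_mk _)
  · rw [Set.disjoint_left]
    rintro _ ⟨x, rfl⟩ ⟨y, h⟩
    exact absurd (Stream'.cons_injective2 h).1 (by decide)
  · rintro j hj _ ⟨x, rfl⟩
    obtain ⟨v, hv⟩ := pingPongElement_zpow (k := j.toAdd) hj
    exact ⟨v ++ₛ x, (hv x).symm⟩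
  · rintro j hj _ ⟨x, rfl⟩
    have h1 := hc.permHom_apply (translationHom k j) (0, true) x
    have h2 : translationHom k j (0, true) ≠ (0, true) := by
      intro h
      exact hj (by simpa [translationHom] using congrArg Prod.fst h)
    rw [dif_pos rfl, dif_neg h2] at h1
    exact ⟨_, h1.symm⟩

/-! ### Baumslag–Solitar groups -/

namespace BaumslagSolitar

variable {m n : ℤ} {G : Type*} [Group G]

/-- The generator `a` of `BS(m, n)`. -/
abbrev a (m n : ℤ) : BaumslagSolitar m n := PresentedGroup.of 0

/-- The stable letter `b` of `BS(m, n)`. -/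
abbrev b (m n : ℤ) : BaumslagSolitar m n := PresentedGroup.of 1

theorem relation (m n : ℤ) : (b m n)⁻¹ * a m n ^ m * b m n = a m n ^ n :=
  mul_inv_eq_one.1 (PresentedGroup.one_of_mem (Set.mem_singleton (bsRelator m n)))

/-- The homomorphism from `BS(m, n)` with `a ↦ x` and `b ↦ y`. -/
def lift (x y : G) (h : y⁻¹ * x ^ m * y = x ^ n) : BaumslagSolitar m n →* G :=
  PresentedGroup.toGroup (f := ![x, y]) (by
    rintro _ rfl
    simp [bsRelator, h])

theorem lift_a {x y : G} (h : y⁻¹ * x ^ m * y = x ^ n) : lift x y h (a m n) = x :=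
  PresentedGroup.toGroup.of _

theorem lift_b {x y : G} (h : y⁻¹ * x ^ m * y = x ^ n) : lift x y h (b m n) = y :=
  PresentedGroup.toGroup.of _

theorem hom_ext {f g : BaumslagSolitar m n →* G} (ha : f (a m n) = g (a m n))
    (hb : f (b m n) = g (b m n)) : f = g :=
  PresentedGroup.ext fun x => by fin_cases x <;> assumption

/-- The generator `a` has infinite order: it acts on `ℚ` as a translation, with `b` acting as
multiplication by `m / n`. -/
theorem a_zpow_ne_one (hm : m ≠ 0) (hn : n ≠ 0) {d : ℤ} (hd : d ≠ 0) : a m n ^ d ≠ 1 := by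
  have hm' : (m : ℚ) ≠ 0 := by exact_mod_cast hm
  have hn' : (n : ℚ) ≠ 0 := by exact_mod_cast hn
  have hq : (m / n : ℚ) ≠ 0 := div_ne_zero hm' hn'
  have hA : ∀ k : ℤ, ∀ x : ℚ, (Equiv.addRight (1 : ℚ) ^ k : Equiv.Perm ℚ) x = x + k := by
    intro k x
    induction k generalizing x with
    | zero => simp
    | succ k ih =>
      rw [zpow_add_one, Equiv.Perm.mul_apply, ih, Equiv.coe_addRight]
      push_cast
      ring
    | pred k ih =>
      have : (Equiv.addRight (1 : ℚ) : Equiv.Perm ℚ)⁻¹ x = x - 1 := by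
        rw [Equiv.Perm.inv_eq_iff_eq, Equiv.coe_addRight]
        exact (sub_add_cancel x 1).symm
      rw [zpow_sub_one, Equiv.Perm.mul_apply, this, ih]
      push_cast
      ring
  have h : (Equiv.mulRight₀ (m / n : ℚ) hq : Equiv.Perm ℚ)⁻¹ * (Equiv.addRight (1 : ℚ)) ^ m *
      (Equiv.mulRight₀ (m / n : ℚ) hq : Equiv.Perm ℚ) = (Equiv.addRight (1 : ℚ)) ^ n := by
    rw [mul_assoc, inv_mul_eq_iff_eq_mul]
    ext x
    rw [Equiv.Perm.mul_apply, Equiv.Perm.mul_apply, hA, hA]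
    simp only [Equiv.mulRight₀_apply]
    field_simp
  intro h1
  have h2 := congrArg (lift _ _ h) h1
  rw [map_zpow, lift_a, map_one] at h2
  have h3 := DFunLike.congr_fun h2 (0 : ℚ)
  rw [hA] at h3
  exact hd (by simpa using h3)

theorem normal_zpowers {e : ℤ} (he : e = 1 ∨ e = -1) (hn : n = e * m) :
    (Subgroup.zpowers (a m n ^ m)).Normal := by
  set c := a m n ^ m with hc
  have hbc : (b m n)⁻¹ * c * b m n = c ^ e := by
    rw [hc, relation, ← zpow_mul, hn, mul_comm]
  have hcb : b m n * c * (b m n)⁻¹ = c ^ e := by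
    have hee : c ^ (e * e) = c := by rcases he with rfl | rfl <;> simp
    have h1 : (b m n)⁻¹ * c ^ e * b m n = c := by
      have := conj_zpow (i := e) (a := (b m n)⁻¹) (b := c)
      rw [inv_inv, hbc, ← zpow_mul, hee] at this
      exact this.symm
    conv_lhs => rw [← h1]
    group
  rw [← Subgroup.normalizer_eq_top_iff, eq_top_iff, ← PresentedGroup.closure_range_of,
    Subgroup.closure_le]
  have key : ∀ g : BaumslagSolitar m n, g * c * g⁻¹ ∈ Subgroup.zpowers c →
      g⁻¹ * c * g ∈ Subgroup.zpowers c → g ∈ Subgroup.normalizer (Subgroup.zpowers c : Set _) := by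
    intro g h1 h2
    rw [Subgroup.mem_normalizer_iff]
    intro h
    constructor
    · rintro ⟨k, rfl⟩
      simp only [← conj_zpow]
      exact zpow_mem h1 k
    · rintro ⟨k, hk⟩
      have : h = (g⁻¹ * c * g) ^ k := by
        have h3 : g⁻¹ * c * g = g⁻¹ * c * g⁻¹⁻¹ := by rw [inv_inv]
        rw [h3, conj_zpow]
        simp only at hk
        rw [hk]
        group
      rw [this]
      exact zpow_mem h2 k
  rintro _ ⟨i, rfl⟩
  fin_cases i
  · have h1 : Commute (a m n) c := Commute.self_zpow _ _
    refine key _ ?_ ?_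
    · change a m n * c * (a m n)⁻¹ ∈ _
      rw [h1.eq, mul_inv_cancel_right]
      exact Subgroup.mem_zpowers c
    · change (a m n)⁻¹ * c * a m n ∈ _
      rw [mul_assoc, ← h1.eq, inv_mul_cancel_left]
      exact Subgroup.mem_zpowers c
  · refine key _ ?_ ?_
    · change b m n * c * (b m n)⁻¹ ∈ _
      rw [hcb]
      exact zpow_mem (Subgroup.mem_zpowers c) e
    · change (b m n)⁻¹ * c * b m n ∈ _
      rw [hbc]
      exact zpow_mem (Subgroup.mem_zpowers c) e

/-- A homomorphism through which the quotient by the normal subgroup `⟨a ^ m⟩` factors has its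
kernel in this subgroup. -/
theorem mem_zpowers_of_factor {H : Type*} [Group H] 
    [(Subgroup.zpowers (a m n ^ m)).Normal] (ψ : BaumslagSolitar m n →* H)
    (s : H →* BaumslagSolitar m n ⧸ Subgroup.zpowers (a m n ^ m))
    (ha : s (ψ (a m n)) = (a m n : BaumslagSolitar m n))
    (hb : s (ψ (b m n)) = (b m n : BaumslagSolitar m n))
    {g : BaumslagSolitar m n} (hg : ψ g = 1) :
    g ∈ Subgroup.zpowers (a m n ^ m) := by
  have h : s.comp ψ = QuotientGroup.mk' _ := hom_ext ha hb
  have := DFunLike.congr_fun h g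
  rw [MonoidHom.comp_apply, hg, map_one] at this
  exact (QuotientGroup.eq_one_iff g).1 this.symm

/-- `BS(m, e m)` embeds in the product of its quotient by the normal subgroup `⟨a ^ m⟩`, which is
`ℤ * ℤ/m`, and its image in `BS(1, e)`, where `a ^ m` still has infinite order. -/
theorem exists_injective_prod {e : ℤ} (he : e = 1 ∨ e = -1) {m : ℤ} (hm : m ≠ 0) :
    ∃ φ : BaumslagSolitar m (e * m) →*
        Monoid.Coprod (Multiplicative ℤ) (Multiplicative (ZMod m.natAbs)) × BaumslagSolitar 1 e,
      Function.Injective φ := by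
  have hN := normal_zpowers he (m := m) rfl
  let y : Monoid.Coprod (Multiplicative ℤ) (Multiplicative (ZMod m.natAbs)) :=
    Monoid.Coprod.inr (Multiplicative.ofAdd 1)
  let x : Monoid.Coprod (Multiplicative ℤ) (Multiplicative (ZMod m.natAbs)) :=
    Monoid.Coprod.inl (Multiplicative.ofAdd 1)
  have hy : y ^ m = 1 := by
    have h0 : ((m : ℤ) : ZMod m.natAbs) = 0 :=
      (ZMod.intCast_zmod_eq_zero_iff_dvd m m.natAbs).2 (Int.natAbs_dvd.2 dvd_rfl)
    change Monoid.Coprod.inr (Multiplicative.ofAdd (1 : ZMod m.natAbs)) ^ m = _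
    rw [← map_zpow, ← ofAdd_zsmul, zsmul_one, h0, ofAdd_zero, map_one]
  have h1 : x⁻¹ * y ^ m * x = y ^ (e * m) := by
    rw [mul_comm e m, zpow_mul, hy]
    simp
  have h2 : (b 1 e)⁻¹ * a 1 e ^ m * b 1 e = a 1 e ^ (e * m) := by
    have := conj_zpow (i := m) (a := (b 1 e)⁻¹) (b := a 1 e)
    have h3 := relation 1 e
    rw [zpow_one] at h3
    rw [inv_inv, h3] at this
    rw [← this, zpow_mul]
  refine ⟨(lift y x h1).prod (lift (a 1 e) (b 1 e) h2), ?_⟩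
  rw [injective_iff_map_eq_one]
  intro g hg
  have hg1 : lift y x h1 g = 1 := congrArg Prod.fst hg
  have hg2 : lift (a 1 e) (b 1 e) h2 g = 1 := congrArg Prod.snd hg
  let Q := BaumslagSolitar m (e * m) ⧸ Subgroup.zpowers (a m (e * m) ^ m)
  have hQ : ((a m (e * m) : BaumslagSolitar m (e * m)) : Q) ^ m = 1 :=
    (QuotientGroup.eq_one_iff _).2 (Subgroup.mem_zpowers _)
  let F : {F : ℤ →+ Additive Q // F m.natAbs = 0} := ⟨zmultiplesHom (Additive Q)
    (Additive.ofMul ((a m (e * m) : BaumslagSolitar m (e * m)) : Q)), by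
      rw [zmultiplesHom_apply, ← ofMul_zpow]
      refine congrArg Additive.ofMul ?_
      rcases Int.natAbs_eq m with h | h
      · rw [← h, hQ]
      · rw [← neg_neg (m.natAbs : ℤ), ← h, zpow_neg, hQ, inv_one]⟩
  let q : Multiplicative (ZMod m.natAbs) →* Q :=
    AddMonoidHom.toMultiplicativeLeft (ZMod.lift m.natAbs F)
  have hq : q (Multiplicative.ofAdd 1) = ((a m (e * m) : BaumslagSolitar m (e * m)) : Q) := by
    have h := ZMod.lift_coe m.natAbs F 1
    rw [Int.cast_one] at h
    exact h.trans (one_zsmul _)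
  obtain ⟨k, rfl⟩ := mem_zpowers_of_factor (lift y x h1)
    (Monoid.Coprod.lift (zpowersHom Q (b m (e * m) : BaumslagSolitar m (e * m))) q)
    (by rw [lift_a, Monoid.Coprod.lift_apply_inr, hq])
    (by rw [lift_b, Monoid.Coprod.lift_apply_inl]; simp) hg1
  simp only [map_zpow, lift_a, ← zpow_mul] at hg2
  by_cases hk : k = 0
  · simp [hk]
  · refine absurd hg2 (a_zpow_ne_one one_ne_zero ?_ (mul_ne_zero hm hk))
    rcases he with rfl | rfl <;> decide

/-- `BS(1, e)` embeds in `V`. Given `s` of infinite order with `r⁻¹ s r = s ^ e`, send `a` and `b` to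
`s` and `r` on one half of the Cantor set; on the other half, let `a` act trivially and `b` with
infinite order. -/
theorem exists_injective_thompsonV {e : ℤ} (he : e = 1 ∨ e = -1) :
    ∃ β : BaumslagSolitar 1 e →* ThompsonV, Function.Injective β := by
  obtain ⟨s, r, hs, hr⟩ : ∃ s r : ThompsonV, (∀ k : ℤ, k ≠ 0 → s ^ k ≠ 1) ∧ r⁻¹ * s * r = s ^ e := by
    rcases he with rfl | rfl
    · exact ⟨pingPongElement, 1, fun k => pingPongElement_zpow_ne_one, by simp⟩
    · refine ⟨halvesHom (pingPongElement, pingPongElement⁻¹), halvesSwap, fun k hk h => ?_, ?_⟩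
      · rw [← map_zpow, map_eq_one_iff _ halvesHom_injective] at h
        exact pingPongElement_zpow_ne_one hk (congrArg Prod.fst h)
      · rw [halvesSwap_conj, ← map_zpow]
        simp
  have h1 : r⁻¹ * s ^ (1 : ℤ) * r = s ^ e := by rwa [zpow_one]
  have h2 : pingPongElement⁻¹ * 1 ^ (1 : ℤ) * pingPongElement = 1 ^ e := by simp
  have h3 : (Multiplicative.ofAdd (1 : ℤ))⁻¹ * 1 ^ (1 : ℤ) * Multiplicative.ofAdd (1 : ℤ) = 1 ^ e := by
    simp
  refine ⟨halvesHom.comp ((lift s r h1).prod (lift 1 pingPongElement h2)), ?_⟩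
  rw [MonoidHom.coe_comp]
  refine halvesHom_injective.comp ?_
  rw [injective_iff_map_eq_one]
  intro g hg
  have hg1 : lift s r h1 g = 1 := congrArg Prod.fst hg
  have hg2 : lift 1 pingPongElement h2 g = 1 := congrArg Prod.snd hg
  have hcomp : (zpowersHom ThompsonV pingPongElement).comp (lift 1 (Multiplicative.ofAdd 1) h3) =
      lift 1 pingPongElement h2 :=
    hom_ext (by simp only [MonoidHom.comp_apply, lift_a, map_one])
      (by simp only [MonoidHom.comp_apply, lift_b]; simp)
  have hψ : lift 1 (Multiplicative.ofAdd 1) h3 g = 1 := by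
    by_contra hne
    rw [← hcomp] at hg2
    exact pingPongElement_zpow_ne_one (k := (lift 1 (Multiplicative.ofAdd 1) h3 g).toAdd) hne hg2
  have hN := normal_zpowers he (mul_one e).symm
  obtain ⟨k, rfl⟩ := mem_zpowers_of_factor (lift 1 (Multiplicative.ofAdd 1) h3)
    (zpowersHom _ (b 1 e : BaumslagSolitar 1 e))
    (by
      rw [lift_a, map_one]
      refine ((QuotientGroup.eq_one_iff _).2 ?_).symm
      rw [zpow_one]
      exact Subgroup.mem_zpowers _)
    (by rw [lift_b]; simp) hψ
  simp only [map_zpow, lift_a, zpow_one] at hg1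
  by_cases hk : k = 0
  · simp [hk]
  · exact absurd hg1 (hs k hk)

/-- The squares remove the signs of `m` and `n`. -/
theorem sq_conj {x y : G} (h : y⁻¹ * x ^ m * y = x ^ n) (d : ℤ) :
    (y ^ 2)⁻¹ * (x ^ d) ^ (m.natAbs ^ 2) * y ^ 2 = (x ^ d) ^ (n.natAbs ^ 2) := by
  have key : ∀ k : ℤ, y⁻¹ * x ^ (m * k) * y = x ^ (n * k) := by
    intro k
    rw [zpow_mul, zpow_mul, ← h]
    simpa using (conj_zpow (i := k) (a := y⁻¹) (b := x ^ m)).symm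
  rw [← zpow_natCast (x ^ d), ← zpow_natCast (x ^ d), ← zpow_mul, ← zpow_mul]
  push_cast
  rw [sq_abs, sq_abs]
  calc (y ^ 2)⁻¹ * x ^ (d * m ^ 2) * y ^ 2
      = y⁻¹ * (y⁻¹ * x ^ (m * (m * d)) * y) * y := by
        rw [show d * m ^ 2 = m * (m * d) by ring, pow_two y, mul_inv_rev]
        simp only [mul_assoc]
    _ = x ^ (d * n ^ 2) := by
        rw [key, show n * (m * d) = m * (n * d) by ring, key]; congr 1; ring

/-- If `|m| ≠ |n|`, then the image of `a` in `V` has no attracting or repelling periodic point, since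
`b` would rescale the contraction there by `m / n`. Hence it has finite order. -/
theorem not_injective_thompsonV (hm : m ≠ 0) (hn : n ≠ 0) (hmn : |m| ≠ |n|)
    (f : BaumslagSolitar m n →* ThompsonV) : ¬ Function.Injective f := by
  intro hf
  let A := (f (a m n)).1
  let B := (f (b m n)).1
  have hA : A ∈ ThompsonV := (f (a m n)).2
  have hB : B ∈ ThompsonV := (f (b m n)).2
  have hrel : B⁻¹ * A ^ m * B = A ^ n := by
    have := congrArg (ThompsonV.subtype.comp f) (relation m n)
    simp only [map_mul, map_inv, map_zpow] at this
    exact this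
  obtain ⟨d, hd, h⟩ := exists_pow_eq_one hA fun d _ p r hpr => by
    have hsq := sq_conj hrel d
    have hne : m.natAbs ≠ n.natAbs := fun h => hmn (abs_eq_abs.2 (Int.natAbs_eq_natAbs_iff.1 h))
    rcases lt_or_gt_of_ne hne with hlt | hlt
    · refine eq_nil_of_conj_pow (zpow_mem hA d) (pow_mem hB 2)
        (Nat.pow_lt_pow_left hlt two_ne_zero) ?_ hpr
      rw [← hsq]
      group
    · refine eq_nil_of_conj_pow (zpow_mem hA d) (inv_mem (pow_mem hB 2))
        (Nat.pow_lt_pow_left hlt two_ne_zero) ?_ hpr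
      rw [inv_inv, hsq]
  refine a_zpow_ne_one hm hn (d := d) (by omega) (hf ?_)
  rw [zpow_natCast, map_pow, map_one]
  exact Subtype.ext h

end BaumslagSolitar

theorem theorem1 (m n : ℤ) (hm : m ≠ 0) (hn : n ≠ 0) :
    (|m| ≠ |n| → ¬ ∃ f : BaumslagSolitar m n →* ThompsonV, Function.Injective f) ∧
    (|m| = |n| → ∃ f : BaumslagSolitar m n →* ThompsonV, Function.Injective f) ∧
    (∀ e : ℤ, (e = 1 ∨ e = -1) → n = e * m →
      ∃ (φ : BaumslagSolitar m n →*
            Monoid.Coprod (Multiplicative ℤ) (Multiplicative (ZMod m.natAbs)) × BaumslagSolitar 1 e)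
        (α : Monoid.Coprod (Multiplicative ℤ) (Multiplicative (ZMod m.natAbs)) →* ThompsonV)
        (β : BaumslagSolitar 1 e →* ThompsonV)
        (χ : ThompsonV × ThompsonV →* ThompsonV),
        Function.Injective φ ∧ Function.Injective α ∧ Function.Injective β ∧
          Function.Injective χ) := by
  have factor : ∀ e : ℤ, (e = 1 ∨ e = -1) → n = e * m →
      ∃ (φ : BaumslagSolitar m n →*
            Monoid.Coprod (Multiplicative ℤ) (Multiplicative (ZMod m.natAbs)) × BaumslagSolitar 1 e)
        (α : Monoid.Coprod (Multiplicative ℤ) (Multiplicative (ZMod m.natAbs)) →* ThompsonV)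
        (β : BaumslagSolitar 1 e →* ThompsonV)
        (χ : ThompsonV × ThompsonV →* ThompsonV),
        Function.Injective φ ∧ Function.Injective α ∧ Function.Injective β ∧
          Function.Injective χ := by
    rintro e he rfl
    obtain ⟨φ, hφ⟩ := BaumslagSolitar.exists_injective_prod he hm
    obtain ⟨α, hα⟩ := exists_coprod_zmod_injective (Int.natAbs_ne_zero.2 hm)
    obtain ⟨β, hβ⟩ := BaumslagSolitar.exists_injective_thompsonV he
    exact ⟨φ, α, β, halvesHom, hφ, hα, hβ, halvesHom_injective⟩
  refine ⟨?_, fun hmn => ?_, factor⟩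
  · rintro hmn ⟨f, hf⟩
    exact BaumslagSolitar.not_injective_thompsonV hm hn hmn f hf
  · obtain ⟨e, he, hne⟩ : ∃ e : ℤ, (e = 1 ∨ e = -1) ∧ n = e * m := by
      rcases abs_eq_abs.1 hmn with h | h
      · exact ⟨1, Or.inl rfl, by rw [h, one_mul]⟩
      · exact ⟨-1, Or.inr rfl, by rw [h]; ring⟩
    obtain ⟨φ, α, β, χ, hφ, hα, hβ, hχ⟩ := factor e he hne
    refine ⟨χ.comp ((α.prodMap β).comp φ), ?_⟩
    rw [MonoidHom.coe_comp, MonoidHom.coe_comp]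
    exact hχ.comp ((hα.prodMap hβ).comp hφ)
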